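/- For a finite graph $\mathcal{G}$ let $$\mathrm{cox}(\mathcal{G}) = \langle \sigma_v,\ v\in V(\mathcal{G}) \mid \sigma_v^2=e \ \forall v\in V(\mathcal{G}),\ [\sigma_v,\sigma_w]=e\ \forall \{v,w\}\in E(\mathcal{G})\rangle$$ be its right-angled Coxeter group. For an integer $r\ge 0$ let $\mathcal{A}_r$ be the graph obtained from the complete graph on $r$ vertices by adding two vertices, each adjacent to all $r$ vertices of the complete graph but not to each other. For a group $\Gamma$ and $n\ge 0$ let $h_n(\Gamma)=|\mathrm{Hom}(\Gamma,\mathfrak{S}_n)|$, where $\mathfrak{S}_n$ is the symmetric group on $n$ letters. Put $h_{n,r}=h_n(\mathrm{cox}(\mathcal{A}_r))$ for $n\ge 0$ and $h_{m,r}=0$ for integers $m<0$. For $0\le j\le r$ let $s_{2^j}$ be the number of subgroups of index $2^j$ of $(\mathbb{Z}/2\mathbb{Z})^r$. Let $I_r=(\{0,1\}^{r+1})^3$, with the entries of $\varepsilon\in I_r$ written $\varepsilon_{j,i}$ for $0\le j\le r$, $i\in\{1,2,3\}$, and let $|\varepsilon|=\sum_{j=0}^r(\varepsilon_{j,1}+\varepsilon_{j,2}+\varepsilon_{j,3})\,2^j$.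 **Corollary 5.2.** Let $r\ge 0$ be an integer. Then $h_{0,r}=1$, $h_{m,r}=0$ for all $m<0$, and for all integers $n\geq 0$ $$\begin{aligned} \frac{h_{n+1,r}}{n!} ={}& - \sum_{\substack{\varepsilon \in I_r \setminus \{0\} \\ |\varepsilon| \leq n}} \frac{h_{n-|\varepsilon|+1,r}}{(n-|\varepsilon|)!}\ \prod_{j=0}^r (-1)^{\varepsilon_{j,1}+\varepsilon_{j,2}} \\ & + \sum_{j=0}^r \sum_{\substack{\varepsilon \in I_r \\ \varepsilon_{j,1}=\varepsilon_{j,2}=\varepsilon_{j,3}=0}} \frac{h_{n+1-2^j-|\varepsilon|,r}}{(n+1-2^j-|\varepsilon|)!} \cdot s_{2^j}\cdot 2^{2j} \ \prod_{k\neq j} (-1)^{\varepsilon_{k,1}+\varepsilon_{k,2}} \\ & + \sum_{j=0}^r \sum_{\substack{\varepsilon \in I_r \\ \varepsilon_{j,1}=\varepsilon_{j,2}=\varepsilon_{j,3}=0}} \frac{h_{n+1-2^{j+1}-|\varepsilon|,r}}{(n+1-2^{j+1}-|\varepsilon|)!} \cdot s_{2^j}\cdot (2^j+2^{2j})\ \prod_{k\neq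 j} (-1)^{\varepsilon_{k,1}+\varepsilon_{k,2}} \\ & - \sum_{j=0}^r \sum_{\substack{\varepsilon \in I_r \\ \varepsilon_{j,1}=\varepsilon_{j,2}=\varepsilon_{j,3}=0}} \frac{h_{n+1-3\cdot 2^j-|\varepsilon|,r}}{(n+1-3\cdot 2^j-|\varepsilon|)!} \cdot s_{2^j}\cdot 2^j \ \prod_{k\neq j} (-1)^{\varepsilon_{k,1}+\varepsilon_{k,2}}, \end{aligned}$$ where $k$ ranges over $\{0,\dots,r\}\setminus\{j\}$ and a quotient $h_{m,r}/m!$ with $m<0$ is read as $0$. -/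

import Mathlib

namespace RACox

/-- The relators of the right-angled Coxeter group of a graph, on one generator `σ_v` for each
vertex `v`: `σ_v ^ 2` for all vertices and the commutators `[σ_v, σ_w]` for all edges `{v, w}`. -/
def coxRels {V : Type} (G : SimpleGraph V) : Set (FreeGroup V) :=
  {x | ∃ v, x = FreeGroup.of v ^ 2} ∪
    {x | ∃ v w, G.Adj v w ∧
      x = FreeGroup.of v * FreeGroup.of w * (FreeGroup.of v)⁻¹ * (FreeGroup.of w)⁻¹}

/-- `cox(G)`, the right-angled Coxeter group of the graph `G`. -/
abbrev Cox {V : Type} (G : SimpleGraph V) : Type :=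
  PresentedGroup (coxRels G)

/-- The graph `A_r`: the complete graph on `r` vertices (the left summand) together with two
further vertices (the right summand), each adjacent to every vertex of the complete graph but not
to each other. -/
def graphA (r : ℕ) : SimpleGraph (Fin r ⊕ Fin 2) where
  Adj u v := u ≠ v ∧ ¬ (u.isRight = true ∧ v.isRight = true)
  symm := ⟨fun _ _ h => ⟨h.1.symm, fun h' => h.2 h'.symm⟩⟩
  loopless := ⟨fun _ h => h.1 rfl⟩

/-- `h_n(Γ) = |Hom(Γ, Sym_n)|`. -/
noncomputable def homCount (Γ : Type) [Group Γ] (n : ℕ) : ℕ :=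
  Nat.card (Γ →* Equiv.Perm (Fin n))

/-- `h_{m,r}` for an integer `m`: it is `h_m(cox(A_r))` for `m ≥ 0`, and `0` for `m < 0`. -/
noncomputable def h (r : ℕ) (m : ℤ) : ℕ :=
  if 0 ≤ m then homCount (Cox (graphA r)) m.toNat else 0

/-- `s_d((ℤ/2ℤ)^r)`, the number of subgroups of index `d` of `(ℤ/2ℤ)^r`. -/
noncomputable def s (r d : ℕ) : ℕ :=
  Nat.card {H : AddSubgroup (Fin r → ZMod 2) // H.index = d}

/-- The index set `I_r = ({0,1}^{r+1})^3`. The entry `ε_{j,i}`, with `j = 0, …, r` and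
`i = 1, 2, 3`, is `ε j (i - 1)`. -/
abbrev I (r : ℕ) : Type := Fin (r + 1) → Fin 3 → Fin 2

/-- `|ε| = ∑_j (ε_{j,1} + ε_{j,2} + ε_{j,3}) 2^j`. -/
def wt {r : ℕ} (ε : I r) : ℕ :=
  ∑ j : Fin (r + 1), ((ε j 0 : ℕ) + (ε j 1 : ℕ) + (ε j 2 : ℕ)) * 2 ^ (j : ℕ)

/-- The sign `(-1)^{ε_{j,1} + ε_{j,2}}`. -/
def sgn {r : ℕ} (ε : I r) (j : Fin (r + 1)) : ℚ :=
  (-1) ^ ((ε j 0 : ℕ) + (ε j 1 : ℕ))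

/-- The set of `ε ∈ I_r` with `ε_{j,1} = ε_{j,2} = ε_{j,3} = 0`. -/
def vanishAt (r : ℕ) (j : Fin (r + 1)) : Finset (I r) :=
  Finset.univ.filter fun ε => ε j 0 = 0 ∧ ε j 1 = 0 ∧ ε j 2 = 0

/-- `h_{m,r} / m!` for an integer `m`. For `m < 0` it is `0`, because `h_{m,r} = 0`. -/
noncomputable def hDivFact (r : ℕ) (m : ℤ) : ℚ :=
  (h r m : ℚ) / (m.toNat.factorial : ℚ)

end RACox

namespace RACox

/-! Since the `r` clique vertices are joined to everything, `cox(A_r)` is `(ℤ/2ℤ)^r × D_∞`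
(`coxEquivProd`). Let `t_k` be the number of its subgroups of index `k`, and `F = ∑ h_n X^n / n!`.
Hall's recursion (`mul_homCount_eq_sum`), got by splitting an action with a marked point into the
orbit of that point and the rest, says `X F' = F · ∑_{k ≥ 1} t_k X^k`.

By Goursat, a subgroup of `G × D_∞` with `G` abelian is a triple of `H ≤ G`, `Q ≤ D_∞` and a
homomorphism `Q → G/H`; its index is `[G : H] [D_∞ : Q]`. The subgroups of `D_∞` of index `m ≥ 1`
are `m` copies of `D_∞`, and one copy of `ℤ` if `m` is even. Into an elementary abelian 2-group of
order `d` these have `d²` and `d` homomorphisms. With `y = X^d`, a fixed `H` of index `d = 2^j` thus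
contributes `∑_m m d² y^m + ∑_{m even} d y^m`, a rational function with denominator `(1 - y)²(1 +
y)` (`fiberSeries_mul_denom`).

Multiplying `X F'` by all these denominators for `j = 0, …, r` clears the fractions
(`log_deriv_mul_prod_denom`). Expanding each denominator as a product of three binomials gives the
sums over `ε`, and the coefficient of `X^(n+1)` is the stated recursion. -/

/-! ### The isomorphism of `cox(A_r)` with `(ℤ/2ℤ)^r × D_∞`. -/

/-- The homomorphism from the infinite dihedral group determined by two involutions. -/
def dihedralLift {M : Type*} [Group M] (a b : M) (ha : a * a = 1) (hb : b * b = 1) :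
    DihedralGroup 0 →* M where
  toFun
    | .r i => (a * b) ^ (show ℤ from i)
    | .sr i => a * (a * b) ^ (show ℤ from i)
  map_one' := zpow_zero (a * b)
  map_mul' := by
    have ha' : a⁻¹ = a := inv_eq_of_mul_eq_one_left ha
    have hb' : b⁻¹ = b := inv_eq_of_mul_eq_one_left hb
    -- Conjugation by the involution `a` inverts `a * b`; this is the only relation needed.
    have key : ∀ i : ℤ, (a * b) ^ i * a = a * (a * b) ^ (-i) := by
      intro i
      have h1 : a * (a * b) * a⁻¹ = (a * b)⁻¹ := by
        rw [mul_inv_rev, ha', hb', ← mul_assoc a a b, ha, one_mul]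
      have h2 : (a * (a * b) * a⁻¹) ^ (-i) = a * (a * b) ^ (-i) * a⁻¹ := conj_zpow
      rw [h1, inv_zpow, ← zpow_neg, neg_neg] at h2
      rw [h2, inv_mul_cancel_right]
    rintro (i | i) (j | j)
    · exact zpow_add (a * b) (show ℤ from i) (show ℤ from j)
    · change a * (a * b) ^ ((show ℤ from j) - (show ℤ from i)) =
        (a * b) ^ (show ℤ from i) * (a * (a * b) ^ (show ℤ from j))
      rw [← mul_assoc, key, mul_assoc, ← zpow_add, sub_eq_neg_add]
    · change a * (a * b) ^ ((show ℤ from i) + (show ℤ from j)) =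
        a * (a * b) ^ (show ℤ from i) * (a * b) ^ (show ℤ from j)
      rw [mul_assoc, ← zpow_add]
    · change (a * b) ^ ((show ℤ from j) - (show ℤ from i)) =
        a * (a * b) ^ (show ℤ from i) * (a * (a * b) ^ (show ℤ from j))
      rw [mul_assoc, ← mul_assoc _ a, key, ← mul_assoc, ← mul_assoc, ha, one_mul, ← zpow_add,
        sub_eq_neg_add]

theorem dihedralLift_sr_zero {M : Type*} [Group M] (a b : M) (ha : a * a = 1) (hb : b * b = 1) :
    dihedralLift a b ha hb (.sr 0) = a := by
  change a * (a * b) ^ (0 : ℤ) = a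
  simp

theorem dihedralLift_sr_one {M : Type*} [Group M] (a b : M) (ha : a * a = 1) (hb : b * b = 1) :
    dihedralLift a b ha hb (.sr 1) = b := by
  change a * (a * b) ^ (1 : ℤ) = b
  rw [zpow_one, ← mul_assoc, ha, one_mul]

/-- The reflections `sr 0` and `sr 1` generate `D_∞`, as their product is the rotation `r 1`. -/
theorem dihedral_hom_ext {M : Type*} [Group M] {f g : DihedralGroup 0 →* M}
    (h0 : f (.sr 0) = g (.sr 0)) (h1 : f (.sr 1) = g (.sr 1)) : f = g := by
  have hr1 : f (.r 1) = g (.r 1) := by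
    have : (DihedralGroup.r 1 : DihedralGroup 0) = .sr 0 * .sr 1 := by simp
    rw [this, map_mul, map_mul, h0, h1]
  have hr : ∀ i : ZMod 0, f (.r i) = g (.r i) := by
    intro i
    have : (DihedralGroup.r i : DihedralGroup 0) = .r 1 ^ (show ℤ from i) := by
      rw [DihedralGroup.r_one_zpow]; rfl
    rw [this, map_zpow, map_zpow, hr1]
  ext (i | i)
  · exact hr i
  · have : (DihedralGroup.sr i : DihedralGroup 0) = .sr 0 * .r i := by simp
    rw [this, map_mul, map_mul, h0, hr]

/-- The elementary abelian group `(ℤ/2ℤ)^r`, written multiplicatively. -/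
abbrev ElemTwo (r : ℕ) : Type := Fin r → Multiplicative (ZMod 2)

theorem mulTwo_mul_self (x : Multiplicative (ZMod 2)) : x * x = 1 := by
  revert x; decide

theorem elemTwo_mul_self {r : ℕ} (x : ElemTwo r) : x * x = 1 :=
  funext fun i => mulTwo_mul_self (x i)

/-- The homomorphism from `ℤ/2ℤ` determined by an involution. -/
def twoLift {M : Type*} [Group M] (a : M) (ha : a * a = 1) : Multiplicative (ZMod 2) →* M where
  toFun x := if x = 1 then 1 else a
  map_one' := if_pos rfl
  map_mul' := by
    have h1 : (Multiplicative.ofAdd (1 : ZMod 2)) ≠ 1 := by decide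
    have h2 : ∀ x : Multiplicative (ZMod 2), x = 1 ∨ x = Multiplicative.ofAdd 1 := by decide
    intro x y
    rcases h2 x with rfl | rfl <;> rcases h2 y with rfl | rfl <;>
      simp [h1, ha, mulTwo_mul_self]

theorem twoLift_ofAdd_one {M : Type*} [Group M] (a : M) (ha : a * a = 1) :
    twoLift a ha (Multiplicative.ofAdd 1) = a := by
  have h1 : (Multiplicative.ofAdd (1 : ZMod 2)) ≠ 1 := by decide
  change (if Multiplicative.ofAdd (1 : ZMod 2) = 1 then 1 else a) = a
  exact if_neg h1

theorem two_hom_ext {M : Type*} [Group M] {f g : Multiplicative (ZMod 2) →* M}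
    (h : f (Multiplicative.ofAdd 1) = g (Multiplicative.ofAdd 1)) : f = g := by
  have h2 : ∀ x : Multiplicative (ZMod 2), x = 1 ∨ x = Multiplicative.ofAdd 1 := by decide
  refine MonoidHom.ext fun x => ?_
  rcases h2 x with rfl | rfl
  · rw [map_one, map_one]
  · exact h

theorem cox_of_mul_self {V : Type} (G : SimpleGraph V) (v : V) :
    (PresentedGroup.of v : Cox G) * PresentedGroup.of v = 1 := by
  rw [← pow_two]
  exact PresentedGroup.one_of_mem (rels := coxRels G) (x := FreeGroup.of v ^ 2) (Or.inl ⟨v, rfl⟩)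

theorem cox_of_commute {V : Type} (G : SimpleGraph V) {v w : V} (h : G.Adj v w) :
    Commute (PresentedGroup.of v : Cox G) (PresentedGroup.of w) := by
  have : (PresentedGroup.of v : Cox G) * PresentedGroup.of w * (PresentedGroup.of v)⁻¹ *
      (PresentedGroup.of w)⁻¹ = 1 :=
    PresentedGroup.one_of_mem (rels := coxRels G)
      (x := FreeGroup.of v * FreeGroup.of w * (FreeGroup.of v)⁻¹ * (FreeGroup.of w)⁻¹)
      (Or.inr ⟨v, w, h, rfl⟩)
  rw [mul_inv_eq_one, mul_inv_eq_iff_eq_mul] at this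
  exact this

theorem graphA_adj_inl {r : ℕ} (i : Fin r) {v : Fin r ⊕ Fin 2} (h : Sum.inl i ≠ v) :
    (graphA r).Adj (.inl i) v :=
  ⟨h, fun h' => by simp at h'⟩

/-- The images of the standard generators in `(ℤ/2ℤ)^r × D_∞`. -/
def coxGen (r : ℕ) : Fin r ⊕ Fin 2 → ElemTwo r × DihedralGroup 0
  | .inl i => (Pi.mulSingle i (Multiplicative.ofAdd 1), 1)
  | .inr a => (1, .sr (if a = 0 then 0 else 1))

theorem coxGen_mul_self {r : ℕ} (v : Fin r ⊕ Fin 2) : coxGen r v * coxGen r v = 1 := by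
  rcases v with i | a
  · exact Prod.ext (elemTwo_mul_self _) (one_mul _)
  · exact Prod.ext (one_mul _) (DihedralGroup.sr_mul_self _)

theorem coxGen_commute {r : ℕ} {v w : Fin r ⊕ Fin 2} (h : (graphA r).Adj v w) :
    Commute (coxGen r v) (coxGen r w) := by
  rcases v with i | a <;> rcases w with j | b
  · exact Prod.ext (mul_comm _ _) rfl
  · exact Prod.ext (mul_comm _ _) ((one_mul _).trans (mul_one _).symm)
  · exact Prod.ext (mul_comm _ _) ((mul_one _).trans (one_mul _).symm)
  · exact absurd ⟨rfl, rfl⟩ h.2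

/-- `cox(A_r) → (ℤ/2ℤ)^r × D_∞`. -/
def coxToProd (r : ℕ) : Cox (graphA r) →* ElemTwo r × DihedralGroup 0 :=
  PresentedGroup.toGroup (f := coxGen r) (by
    rintro x (⟨v, rfl⟩ | ⟨v, w, h, rfl⟩)
    · simp [pow_two, coxGen_mul_self]
    · simp [(coxGen_commute h).eq])

theorem twoLift_commute {M : Type*} [Group M] (a b : M) (ha : a * a = 1) (h : Commute a b)
    (x : Multiplicative (ZMod 2)) : Commute (twoLift a ha x) b := by
  change Commute (if x = 1 then 1 else a) b
  split_ifs
  exacts [Commute.one_left b, h]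

theorem elemTwoToCox_comm (r : ℕ) : Pairwise fun i j : Fin r => ∀ x y,
    Commute (twoLift (PresentedGroup.of (.inl i) : Cox (graphA r)) (cox_of_mul_self _ _) x)
      (twoLift (PresentedGroup.of (.inl j) : Cox (graphA r)) (cox_of_mul_self _ _) y) := by
  intro i j hij x y
  refine twoLift_commute _ _ _ (twoLift_commute _ _ _ ?_ y).symm x
  exact cox_of_commute _ (graphA_adj_inl j (by simpa using hij.symm))

/-- `(ℤ/2ℤ)^r → cox(A_r)`. -/
def elemTwoToCox (r : ℕ) : ElemTwo r →* Cox (graphA r) :=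
  MonoidHom.noncommPiCoprod
    (fun i => twoLift (PresentedGroup.of (.inl i)) (cox_of_mul_self _ _)) (elemTwoToCox_comm r)

theorem elemTwoToCox_mulSingle {r : ℕ} (i : Fin r) :
    elemTwoToCox r (Pi.mulSingle i (Multiplicative.ofAdd 1)) = PresentedGroup.of (.inl i) := by
  rw [elemTwoToCox, MonoidHom.noncommPiCoprod_mulSingle, twoLift_ofAdd_one]

/-- `D_∞ → cox(A_r)`. -/
def dihedralToCox (r : ℕ) : DihedralGroup 0 →* Cox (graphA r) :=
  dihedralLift (PresentedGroup.of (.inr 0)) (PresentedGroup.of (.inr 1))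
    (cox_of_mul_self _ _) (cox_of_mul_self _ _)

theorem dihedralToCox_gen {r : ℕ} (a : Fin 2) :
    dihedralToCox r (.sr (if a = 0 then 0 else 1)) = PresentedGroup.of (.inr a) := by
  fin_cases a
  · exact dihedralLift_sr_zero _ _ _ _
  · exact dihedralLift_sr_one _ _ _ _

/-- Each clique vertex is adjacent to both extra vertices, so the generators commute; this passes to
products on the left and to powers of the rotation on the right. -/
theorem elemTwoToCox_commute_dihedralToCox {r : ℕ} (x : ElemTwo r) (y : DihedralGroup 0) :
    Commute (elemTwoToCox r x) (dihedralToCox r y) := by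
  have key : ∀ (i : Fin r) (a : Fin 2),
      Commute (PresentedGroup.of (.inl i) : Cox (graphA r)) (PresentedGroup.of (.inr a)) :=
    fun i a => cox_of_commute _ (graphA_adj_inl i (by simp))
  have h1 : ∀ (x : ElemTwo r) (a : Fin 2),
      Commute (elemTwoToCox r x) (PresentedGroup.of (.inr a)) := by
    intro x a
    refine Commute.symm (Finset.noncommProd_commute Finset.univ (fun i => twoLift
      (PresentedGroup.of (.inl i) : Cox (graphA r)) (cox_of_mul_self _ _) (x i))
      (fun i _ j _ h => elemTwoToCox_comm r h _ _) _ fun i _ => ?_)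
    exact (twoLift_commute _ _ _ (key i a) _).symm
  have h2 : Commute (elemTwoToCox r x)
      ((PresentedGroup.of (.inr 0) : Cox (graphA r)) * PresentedGroup.of (.inr 1)) :=
    (h1 x 0).mul_right (h1 x 1)
  rcases y with i | i
  · exact h2.zpow_right (show ℤ from i)
  · exact (h1 x 0).mul_right (h2.zpow_right (show ℤ from i))

/-- `(ℤ/2ℤ)^r × D_∞ → cox(A_r)`. -/
def prodToCox (r : ℕ) : ElemTwo r × DihedralGroup 0 →* Cox (graphA r) :=
  MonoidHom.noncommCoprod (elemTwoToCox r) (dihedralToCox r) elemTwoToCox_commute_dihedralToCox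

theorem prodToCox_coxGen {r : ℕ} (v : Fin r ⊕ Fin 2) :
    prodToCox r (coxGen r v) = PresentedGroup.of v := by
  rcases v with i | a
  · change elemTwoToCox r (Pi.mulSingle i (Multiplicative.ofAdd 1)) * dihedralToCox r 1 = _
    rw [elemTwoToCox_mulSingle, map_one (dihedralToCox r), mul_one]
  · change elemTwoToCox r 1 * dihedralToCox r (.sr (if a = 0 then 0 else 1)) = _
    rw [map_one, one_mul, dihedralToCox_gen]

theorem coxToProd_of {r : ℕ} (v : Fin r ⊕ Fin 2) :
    coxToProd r (PresentedGroup.of v) = coxGen r v :=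
  PresentedGroup.toGroup.of _

theorem elemTwo_hom_ext {r : ℕ} {M : Type*} [Group M] {f g : ElemTwo r →* M}
    (h : ∀ i, f (Pi.mulSingle i (Multiplicative.ofAdd 1)) =
      g (Pi.mulSingle i (Multiplicative.ofAdd 1))) : f = g := by
  refine MonoidHom.noncommPiCoprodEquiv.symm.injective (Subtype.ext (funext fun i => ?_))
  exact two_hom_ext (h i)

theorem coxToProd_comp_prodToCox (r : ℕ) :
    (coxToProd r).comp (prodToCox r) = MonoidHom.id (ElemTwo r × DihedralGroup 0) := by
  have hgen : ∀ v, coxToProd r (prodToCox r (coxGen r v)) = coxGen r v := fun v => by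
    rw [prodToCox_coxGen, coxToProd_of]
  have h1 : ((coxToProd r).comp (prodToCox r)).comp (MonoidHom.inl _ _) = MonoidHom.inl _ _ :=
    elemTwo_hom_ext fun i => hgen (.inl i)
  have h2 : ((coxToProd r).comp (prodToCox r)).comp (MonoidHom.inr _ _) = MonoidHom.inr _ _ :=
    dihedral_hom_ext (hgen (.inr 0)) (hgen (.inr 1))
  refine MonoidHom.ext fun x => ?_
  have hx : x = MonoidHom.inl _ _ x.1 * MonoidHom.inr _ _ x.2 := by simp
  rw [hx, map_mul]
  exact congrArg₂ (· * ·) (DFunLike.congr_fun h1 x.1) (DFunLike.congr_fun h2 x.2)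

/-- `cox(A_r) ≅ (ℤ/2ℤ)^r × D_∞`. -/
def coxEquivProd (r : ℕ) : Cox (graphA r) ≃* ElemTwo r × DihedralGroup 0 :=
  MonoidHom.toMulEquiv (coxToProd r) (prodToCox r)
    (by
      ext v
      simp [coxToProd_of, prodToCox_coxGen])
    (coxToProd_comp_prodToCox r)

/-! ### Pointed permutation actions and Hall's recursion. -/

section Orbit
variable {Γ X : Type*} [Group Γ]

/-- The action on `X` glued from the action on a transitive `Γ`-set embedded in `X` and an action
on the complement of its image. -/
noncomputable def glueAction (B : Subgroup Γ) (f : Γ ⧸ B ↪ X)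
    (ψ : Γ →* Equiv.Perm ↥(Set.range f)ᶜ) : Γ →* Equiv.Perm X :=
  letI := Classical.decPred (· ∈ Set.range f)
  (((Equiv.sumCongr (Equiv.ofInjective f f.injective) (Equiv.refl _)).trans
    (Equiv.Set.sumCompl (Set.range f))).permCongrHom).toMonoidHom.comp
      ((Equiv.Perm.sumCongrHom _ _).comp (MonoidHom.prod (MulAction.toPermHom Γ (Γ ⧸ B)) ψ))

theorem glueAction_apply_range (B : Subgroup Γ) (f : Γ ⧸ B ↪ X)
    (ψ : Γ →* Equiv.Perm ↥(Set.range f)ᶜ) (g : Γ) (q : Γ ⧸ B) :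
    glueAction B f ψ g (f q) = f (g • q) := by
  let := Classical.decPred (· ∈ Set.range f)
  have h : (Equiv.ofInjective f f.injective).symm ⟨f q, Set.mem_range_self q⟩ = q := by
    rw [Equiv.symm_apply_eq]; rfl
  simp [glueAction, Equiv.permCongrHom, Equiv.permCongr_apply, h,
    Equiv.Set.sumCompl_symm_apply_of_mem (Set.mem_range_self q)]

theorem glueAction_apply_compl (B : Subgroup Γ) (f : Γ ⧸ B ↪ X)
    (ψ : Γ →* Equiv.Perm ↥(Set.range f)ᶜ) (g : Γ) (y : ↥(Set.range f)ᶜ) :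
    glueAction B f ψ g y = ψ g y := by
  let := Classical.decPred (· ∈ Set.range f)
  simp [glueAction, Equiv.permCongrHom, Equiv.permCongr_apply, Equiv.Set.sumCompl_symm_apply_of_notMem y.2]

/-- Everything is recovered from the action and the marked point: `f` is the orbit map, `B` the
stabilizer of the point, and `ψ` the restriction to the complement of the orbit. -/
theorem glueAction_injective {B B' : Subgroup Γ} {f : Γ ⧸ B ↪ X} {f' : Γ ⧸ B' ↪ X}
    {ψ : Γ →* Equiv.Perm ↥(Set.range f)ᶜ} {ψ' : Γ →* Equiv.Perm ↥(Set.range f')ᶜ}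
    (h : glueAction B f ψ = glueAction B' f' ψ') (h1 : f (1 : Γ) = f' (1 : Γ)) :
    (⟨B, f, ψ⟩ : Σ (B : Subgroup Γ) (f : Γ ⧸ B ↪ X), Γ →* Equiv.Perm ↥(Set.range f)ᶜ) =
      ⟨B', f', ψ'⟩ := by
  have hf : ∀ g : Γ, f (g : Γ ⧸ B) = f' (g : Γ ⧸ B') := by
    intro g
    have e := glueAction_apply_range B f ψ g (1 : Γ)
    have e' := glueAction_apply_range B' f' ψ' g (1 : Γ)
    rw [h, h1, e'] at e
    simpa using e.symm
  have hB : B = B' := by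
    ext g
    have e : (g : Γ ⧸ B) = (1 : Γ) ↔ (g : Γ ⧸ B') = (1 : Γ) := by
      rw [← f.injective.eq_iff, ← f'.injective.eq_iff, hf, hf]
    simpa [QuotientGroup.eq] using e
  subst hB
  have hf' : f = f' := by
    ext q
    obtain ⟨g, rfl⟩ := QuotientGroup.mk_surjective q
    exact hf g
  subst hf'
  have hψ : ψ = ψ' := by
    ext g y
    rw [← glueAction_apply_compl B f ψ, ← glueAction_apply_compl B f ψ', h]
  rw [hψ]

/-- Orbit-stabilizer: `B` is the stabilizer of `x`, `f` embeds the orbit, and the complement of an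
orbit is invariant. -/
theorem exists_glueAction (φ : Γ →* Equiv.Perm X) (x : X) :
    ∃ (B : Subgroup Γ) (f : Γ ⧸ B ↪ X) (ψ : Γ →* Equiv.Perm ↥(Set.range f)ᶜ),
      glueAction B f ψ = φ ∧ f (1 : Γ) = x := by
  let _ : MulAction Γ X := MulAction.compHom X φ
  let f : Γ ⧸ MulAction.stabilizer Γ x ↪ X :=
    ⟨MulAction.ofQuotientStabilizer Γ x, MulAction.injective_ofQuotientStabilizer Γ x⟩
  have hf : ∀ g q, f (g • q) = φ g (f q) := fun g q =>
    MulAction.ofQuotientStabilizer_smul Γ x g q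
  have hr : ∀ (g : Γ) (y : X), φ g y ∈ (Set.range f)ᶜ ↔ y ∈ (Set.range f)ᶜ := by
    intro g y
    refine not_congr ⟨?_, ?_⟩
    · rintro ⟨q, hq⟩
      refine ⟨g⁻¹ • q, ?_⟩
      rw [hf, hq, map_inv, ← Equiv.Perm.mul_apply, inv_mul_cancel, Equiv.Perm.one_apply]
    · rintro ⟨q, rfl⟩
      exact ⟨g • q, hf g q⟩
  let ψ : Γ →* Equiv.Perm ↥(Set.range f)ᶜ :=
    { toFun := fun g => (φ g).subtypePerm (hr g)
      map_one' := Equiv.ext fun y => Subtype.ext (by simp)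
      map_mul' := fun a b => Equiv.ext fun y => Subtype.ext (by
        change φ (a * b) y = φ a (φ b y)
        rw [map_mul, Equiv.Perm.mul_apply]) }
  refine ⟨MulAction.stabilizer Γ x, f, ψ, ?_, one_smul Γ x⟩
  ext g y
  by_cases hy : y ∈ Set.range f
  · obtain ⟨q, rfl⟩ := hy
    rw [glueAction_apply_range, hf]
  · exact glueAction_apply_compl _ f ψ g ⟨y, hy⟩

/-- A permutation action with a marked point is a transitive action (given by a stabilizer)
embedded in the set, together with an action on the complement. -/
noncomputable def pointedActionEquiv (Γ X : Type*) [Group Γ] :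
    (Σ (B : Subgroup Γ) (f : Γ ⧸ B ↪ X), Γ →* Equiv.Perm ↥(Set.range f)ᶜ) ≃
      (Γ →* Equiv.Perm X) × X :=
  Equiv.ofBijective (fun t => (glueAction t.1 t.2.1 t.2.2, t.2.1 (1 : Γ))) (by
    constructor
    · rintro ⟨B, f, ψ⟩ ⟨B', f', ψ'⟩ h
      exact glueAction_injective (congrArg Prod.fst h) (congrArg Prod.snd h)
    · rintro ⟨φ, x⟩
      obtain ⟨B, f, ψ, h1, h2⟩ := exists_glueAction φ x
      exact ⟨⟨B, f, ψ⟩, Prod.ext h1 h2⟩)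

end Orbit

theorem homCount_of_card {Γ X : Type} [Group Γ] [Finite X] :
    Nat.card (Γ →* Equiv.Perm X) = homCount Γ (Nat.card X) :=
  Nat.card_congr (MulEquiv.monoidHomCongrRightEquiv (Finite.equivFin X).permCongrHom)

theorem homCount_congr {Γ Γ' : Type} [Group Γ] [Group Γ'] (e : Γ ≃* Γ') (n : ℕ) :
    homCount Γ n = homCount Γ' n :=
  Nat.card_congr e.monoidHomCongrLeftEquiv

/-- The number of subgroups of index `k`. -/
noncomputable def subgroupCount (Γ : Type*) [Group Γ] (k : ℕ) : ℕ :=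
  Nat.card {B : Subgroup Γ // B.index = k}

/-- Sorting pointed actions on `Fin n` by the size of the orbit of the marked point. -/
noncomputable def pointedActionIndexEquiv (Γ : Type) [Group Γ] (n : ℕ) :
    (Σ (B : Subgroup Γ) (f : Γ ⧸ B ↪ Fin n), Γ →* Equiv.Perm ↥(Set.range f)ᶜ) ≃
      Σ (k : Finset.Icc 1 n) (B : {B : Subgroup Γ // B.index = k}) (f : Γ ⧸ B.1 ↪ Fin n),
        Γ →* Equiv.Perm ↥(Set.range f)ᶜ where
  toFun t := ⟨⟨t.1.index, by
    have : Finite (Γ ⧸ t.1) := Finite.of_injective _ t.2.1.injective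
    rw [Finset.mem_Icc]
    refine ⟨Nat.card_pos, ?_⟩
    exact (Nat.card_le_card_of_injective _ t.2.1.injective).trans_eq (Nat.card_fin n)⟩, ⟨t.1, rfl⟩, t.2.1, t.2.2⟩
  invFun t := ⟨t.2.1.1, t.2.2.1, t.2.2.2⟩
  left_inv _ := rfl
  right_inv := by
    rintro ⟨⟨k, hk⟩, ⟨B, hB⟩, t⟩
    cases hB
    rfl

/-- The complement of the image always has `n - B.index` points, so the second factor does not
depend on the embedding. If `B.index > n` the truncated subtraction is harmless, because the falling
factorial vanishes. -/
theorem card_embedding_actions {Γ : Type} [Group Γ] (B : Subgroup Γ) (n : ℕ) (hB : 0 < B.index)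
    (hfin : ∀ m, Finite (Γ →* Equiv.Perm (Fin m))) :
    Nat.card (Σ (f : Γ ⧸ B ↪ Fin n), Γ →* Equiv.Perm ↥(Set.range f)ᶜ) =
      n.descFactorial B.index * homCount Γ (n - B.index) := by
  have : Finite (Γ ⧸ B) := Nat.finite_of_card_ne_zero hB.ne'
  have : Fintype (Γ ⧸ B) := Fintype.ofFinite _
  have : ∀ f : Γ ⧸ B ↪ Fin n, Finite (Γ →* Equiv.Perm ↥(Set.range f)ᶜ) := fun f =>
    Finite.of_equiv _ (MulEquiv.monoidHomCongrRightEquiv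
      (Finite.equivFin ↥(Set.range f)ᶜ).permCongrHom).symm
  have hc : ∀ f : Γ ⧸ B ↪ Fin n, Nat.card ↥(Set.range f)ᶜ = n - B.index := by
    intro f
    rw [Nat.card_coe_set_eq, Set.ncard_compl, Nat.card_fin, ← Nat.card_coe_set_eq,
      ← Nat.card_congr (Equiv.ofInjective f f.injective), Subgroup.index]
  rw [Nat.card_sigma]
  simp only [homCount_of_card, hc]
  rw [Finset.sum_const, Finset.card_univ, Fintype.card_embedding_eq, smul_eq_mul, Fintype.card_fin,
    Subgroup.index, Nat.card_eq_fintype_card]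

/-- M. Hall's recursion. -/
theorem mul_homCount_eq_sum {Γ : Type} [Group Γ] (hfin : ∀ m, Finite (Γ →* Equiv.Perm (Fin m)))
    (hsub : ∀ k, 0 < k → Finite {B : Subgroup Γ // B.index = k}) (n : ℕ) :
    homCount Γ n * n = ∑ k ∈ Finset.Icc 1 n,
      subgroupCount Γ k * (n.descFactorial k * homCount Γ (n - k)) := by
  -- Double counting of actions on `Fin n` with a marked point.
  have h0 : homCount Γ n * n = Nat.card ((Γ →* Equiv.Perm (Fin n)) × Fin n) := by
    rw [Nat.card_prod, Nat.card_fin, homCount]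
  have : ∀ k : Finset.Icc 1 n, Finite {B : Subgroup Γ // B.index = k} := fun k =>
    hsub k (Finset.mem_Icc.1 k.2).1
  have hpos : ∀ (k : Finset.Icc 1 n) (B : {B : Subgroup Γ // B.index = k}), 0 < B.1.index := by
    intro k B
    rw [B.2]
    exact (Finset.mem_Icc.1 k.2).1
  have : Finite ((Γ →* Equiv.Perm (Fin n)) × Fin n) := inferInstance
  -- Splitting the cardinality of a sigma type into a sum requires finite fibres; they inherit
  -- finiteness from the total space.
  have hF := Finite.of_equiv _ ((pointedActionEquiv Γ (Fin n)).symm.trans (pointedActionIndexEquiv Γ n))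
  have hF1 : ∀ (k : Finset.Icc 1 n) (B : {B : Subgroup Γ // B.index = k}),
      Finite (Σ (f : Γ ⧸ B.1 ↪ Fin n), Γ →* Equiv.Perm ↥(Set.range f)ᶜ) := fun k B =>
    Finite.of_injective (fun t => (⟨k, B, t⟩ : Σ (k : Finset.Icc 1 n)
      (B : {B : Subgroup Γ // B.index = k}) (f : Γ ⧸ B.1 ↪ Fin n),
        Γ →* Equiv.Perm ↥(Set.range f)ᶜ)) (fun a b h => by simpa using h)
  rw [h0, Nat.card_congr ((pointedActionEquiv Γ (Fin n)).symm.trans (pointedActionIndexEquiv Γ n)),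
    Nat.card_sigma, ← Finset.sum_coe_sort (Finset.Icc 1 n)]
  refine Finset.sum_congr rfl fun k _ => ?_
  have : Fintype {B : Subgroup Γ // B.index = k} := Fintype.ofFinite _
  have hB : ∀ B : {B : Subgroup Γ // B.index = k},
      Nat.card (Σ (f : Γ ⧸ B.1 ↪ Fin n), Γ →* Equiv.Perm ↥(Set.range f)ᶜ) =
        n.descFactorial k * homCount Γ (n - k) := fun B => by
    rw [card_embedding_actions B.1 n (hpos k B) hfin, B.2]
  rw [Nat.card_sigma, Finset.sum_congr rfl fun B _ => hB B,
    Finset.sum_const, Finset.card_univ, smul_eq_mul, subgroupCount, Nat.card_eq_fintype_card]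

/-! ### Goursat's lemma with one commutative factor. -/

section Product
variable {G Γ : Type*} [CommGroup G] [Group Γ]

/-- The projection `G × Q → G ⧸ H` twisted by `φ : Q → G ⧸ H`. -/
def twistedProj (H : Subgroup G) (Q : Subgroup Γ) (φ : Q →* G ⧸ H) :
    ↥(Q.comap (MonoidHom.snd G Γ)) →* G ⧸ H where
  toFun x := (x.1.1 : G ⧸ H) / φ ⟨x.1.2, x.2⟩
  map_one' := by
    have : φ ⟨1, Q.one_mem⟩ = 1 := map_one φ
    simp [this]
  map_mul' := by
    rintro ⟨⟨a, q⟩, hq⟩ ⟨⟨b, q'⟩, hq'⟩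
    have : φ ⟨q * q', Q.mul_mem hq hq'⟩ = φ ⟨q, hq⟩ * φ ⟨q', hq'⟩ := map_mul φ ⟨q, hq⟩ ⟨q', hq'⟩
    simp [this, mul_div_mul_comm]

/-- The subgroup of `G × Γ` given by Goursat data. -/
def goursatSubgroup (H : Subgroup G) (Q : Subgroup Γ) (φ : Q →* G ⧸ H) : Subgroup (G × Γ) :=
  (twistedProj H Q φ).ker.map (Subgroup.subtype _)

theorem mem_goursatSubgroup {H : Subgroup G} {Q : Subgroup Γ} {φ : Q →* G ⧸ H} {x : G × Γ} :
    x ∈ goursatSubgroup H Q φ ↔ ∃ hq : x.2 ∈ Q, φ ⟨x.2, hq⟩ = (x.1 : G ⧸ H) := by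
  constructor
  · rintro ⟨⟨x, hx⟩, h, rfl⟩
    exact ⟨hx, (div_eq_one.1 h).symm⟩
  · rintro ⟨hq, h⟩
    exact ⟨⟨x, hq⟩, div_eq_one.2 h.symm, rfl⟩

/-- The subgroup is the kernel of a map from `G × Q` onto `G ⧸ H`, already surjective on `G × 1`,
and `G × Q` has the index of `Q`. -/
theorem index_goursatSubgroup (H : Subgroup G) (Q : Subgroup Γ) (φ : Q →* G ⧸ H) :
    (goursatSubgroup H Q φ).index = H.index * Q.index := by
  have hsurj : Function.Surjective (twistedProj H Q φ) := by
    intro y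
    obtain ⟨g, rfl⟩ := QuotientGroup.mk_surjective y
    refine ⟨⟨(g, 1), Q.one_mem⟩, ?_⟩
    have : φ ⟨1, Q.one_mem⟩ = 1 := map_one φ
    simp [twistedProj, this]
  rw [goursatSubgroup, Subgroup.index_map_subtype, Subgroup.index_ker,
    MonoidHom.range_eq_top.2 hsurj, Subgroup.index_comap_of_surjective _ Prod.snd_surjective,
    Subgroup.card_top, H.index_eq_card]

/-- `H` is the slice over `1`, `Q` the projection to `Γ`, and `φ` is read off from the pairs `(g,
q)` in the subgroup. -/
theorem goursatSubgroup_injective {H H' : Subgroup G} {Q Q' : Subgroup Γ} {φ : Q →* G ⧸ H}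
    {φ' : Q' →* G ⧸ H'} (h : goursatSubgroup H Q φ = goursatSubgroup H' Q' φ') :
    (⟨H, Q, φ⟩ : Σ (H : Subgroup G) (Q : Subgroup Γ), Q →* G ⧸ H) = ⟨H', Q', φ'⟩ := by
  have hH : ∀ (H : Subgroup G) (Q : Subgroup Γ) (φ : Q →* G ⧸ H) (g : G),
      g ∈ H ↔ (g, (1 : Γ)) ∈ goursatSubgroup H Q φ := by
    intro H Q φ g
    have : φ ⟨1, Q.one_mem⟩ = 1 := map_one φ
    rw [mem_goursatSubgroup]
    simp [this, Q.one_mem, eq_comm (a := (1 : G ⧸ H))]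
  have hQ : ∀ (H : Subgroup G) (Q : Subgroup Γ) (φ : Q →* G ⧸ H) (q : Γ),
      q ∈ Q ↔ ∃ g, (g, q) ∈ goursatSubgroup H Q φ := by
    intro H Q φ q
    simp only [mem_goursatSubgroup]
    refine ⟨fun hq => ?_, fun ⟨g, hq, _⟩ => hq⟩
    obtain ⟨g, hg⟩ := QuotientGroup.mk_surjective (φ ⟨q, hq⟩)
    exact ⟨g, hq, hg.symm⟩
  obtain rfl : H = H' := by
    ext g
    rw [hH H Q φ, h, ← hH]
  obtain rfl : Q = Q' := by
    ext q
    rw [hQ H Q φ, h, ← hQ]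
  have : φ = φ' := by
    ext ⟨q, hq⟩
    obtain ⟨g, hg⟩ := QuotientGroup.mk_surjective (φ ⟨q, hq⟩)
    have h1 : (g, q) ∈ goursatSubgroup H Q φ := mem_goursatSubgroup.2 ⟨hq, hg.symm⟩
    rw [h] at h1
    obtain ⟨_, h2⟩ := mem_goursatSubgroup.1 h1
    rw [← hg, h2]
  rw [this]

theorem exists_goursatSubgroup (B : Subgroup (G × Γ)) :
    ∃ (H : Subgroup G) (Q : Subgroup Γ) (φ : Q →* G ⧸ H), goursatSubgroup H Q φ = B := by
  let H := B.comap (MonoidHom.inl G Γ)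
  let Q := B.map (MonoidHom.snd G Γ)
  have hex : ∀ q : Q, ∃ g : G, (g, q.1) ∈ B := by
    rintro ⟨_, ⟨g, q⟩, hx, rfl⟩
    exact ⟨g, hx⟩
  choose c hc using hex
  -- Two lifts of the same `q` differ by an element of the slice `H`, so the class of the chosen
  -- lift is well defined and multiplicative in `q`.
  have huniq : ∀ (g g' : G) (q : Γ), (g, q) ∈ B → (g', q) ∈ B → (g : G ⧸ H) = g' := by
    intro g g' q h h'
    rw [QuotientGroup.eq]
    have := B.mul_mem (B.inv_mem h) h'
    simpa [H] using this
  let φ : Q →* G ⧸ H := MonoidHom.mk' (fun q => (c q : G ⧸ H)) fun a b =>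
    huniq _ (c a * c b) _ (hc (a * b)) (B.mul_mem (hc a) (hc b))
  refine ⟨H, Q, φ, ?_⟩
  ext ⟨g, q⟩
  rw [mem_goursatSubgroup]
  constructor
  · rintro ⟨hq, h⟩
    have h1 : (c ⟨q, hq⟩)⁻¹ * g ∈ H := QuotientGroup.eq.1 h
    have h2 : ((c ⟨q, hq⟩)⁻¹ * g, (1 : Γ)) ∈ B := h1
    simpa using B.mul_mem (hc ⟨q, hq⟩) h2
  · intro h
    have hq : q ∈ Q := ⟨(g, q), h, rfl⟩
    exact ⟨hq, huniq _ _ q (hc ⟨q, hq⟩) h⟩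

/-- Goursat's description of the subgroups of `G × Γ` for commutative `G`. -/
noncomputable def goursatEquiv (G Γ : Type*) [CommGroup G] [Group Γ] :
    (Σ (H : Subgroup G) (Q : Subgroup Γ), Q →* G ⧸ H) ≃ Subgroup (G × Γ) :=
  Equiv.ofBijective (fun t => goursatSubgroup t.1 t.2.1 t.2.2) (by
    constructor
    · rintro ⟨H, Q, φ⟩ ⟨H', Q', φ'⟩ h
      exact goursatSubgroup_injective h
    · intro B
      obtain ⟨H, Q, φ, h⟩ := exists_goursatSubgroup B
      exact ⟨⟨H, Q, φ⟩, h⟩)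

end Product

/-! ### Subgroups of `D_∞`, their indices and their homomorphisms. -/

section Dihedral

open DihedralGroup

/-- The homomorphism `D_∞ → D_∞` that scales by `m` and translates the reflections by `i`. -/
def scaleHom (m : ℕ) (i : ZMod 0) : DihedralGroup 0 →* DihedralGroup 0 where
  toFun
    | r j => r ((m : ZMod 0) * j)
    | sr j => sr (i + (m : ZMod 0) * j)
  map_one' := congrArg r (mul_zero (m : ZMod 0))
  map_mul' := by
    rintro (a | a) (b | b)
    · simp [mul_add]
    · simp [mul_sub, add_sub_assoc]
    · simp [mul_add, add_assoc]
    · simp [mul_sub]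

theorem natCast_zmod_zero_ne_zero {m : ℕ} (hm : m ≠ 0) : (m : ZMod 0) ≠ 0 := by
  rwa [Ne, CharP.cast_eq_zero_iff (ZMod 0) 0, zero_dvd_iff]

theorem natCast_mul_left_cancel {m : ℕ} (hm : m ≠ 0) {a b : ZMod 0}
    (h : (m : ZMod 0) * a = m * b) : a = b :=
  mul_left_cancel₀ (M₀ := ℤ) (natCast_zmod_zero_ne_zero hm) h

theorem scaleHom_injective {m : ℕ} (hm : m ≠ 0) (i : ZMod 0) :
    Function.Injective (scaleHom m i) := by
  rintro (a | a) (b | b) h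
  · exact congrArg _ (natCast_mul_left_cancel hm (r.inj h))
  · cases h
  · cases h
  · exact congrArg _ (natCast_mul_left_cancel hm (add_left_cancel (sr.inj h)))

theorem r_mem_range_scaleHom {m : ℕ} {i j : ZMod 0} :
    r j ∈ (scaleHom m i).range ↔ (m : ZMod 0) ∣ j := by
  constructor
  · rintro ⟨a | a, h⟩
    · exact ⟨a, (r.inj h).symm⟩
    · cases h
  · rintro ⟨a, rfl⟩
    exact ⟨r a, rfl⟩

theorem sr_mem_range_scaleHom {m : ℕ} {i j : ZMod 0} :
    sr j ∈ (scaleHom m i).range ↔ (m : ZMod 0) ∣ j - i := by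
  constructor
  · rintro ⟨a | a, h⟩
    · cases h
    · exact ⟨a, sub_eq_of_eq_add' (sr.inj h).symm⟩
  · rintro ⟨a, h⟩
    exact ⟨sr a, congrArg sr (by rw [← h, add_sub_cancel])⟩

/-- The subgroup of `D_∞` consisting of the rotations by multiples of `c`. -/
def rotSubgroup (c : ℕ) : Subgroup (DihedralGroup 0) :=
  (zpowersHom (DihedralGroup 0) (r c)).range

theorem rotHom_apply (c : ℕ) (k : Multiplicative ℤ) :
    zpowersHom (DihedralGroup 0) (r c) k = r ((c : ZMod 0) * Int.cast k.toAdd) := by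
  rw [zpowersHom_apply, r_zpow]

theorem rotHom_injective {c : ℕ} (hc : c ≠ 0) :
    Function.Injective (zpowersHom (DihedralGroup 0) (r c)) := by
  intro a b h
  rw [rotHom_apply, rotHom_apply] at h
  have := natCast_mul_left_cancel hc (r.inj h)
  exact Int.cast_injective (α := ℤ) this

theorem r_mem_rotSubgroup {c : ℕ} {j : ZMod 0} : r j ∈ rotSubgroup c ↔ (c : ZMod 0) ∣ j := by
  constructor
  · rintro ⟨k, h⟩
    rw [rotHom_apply] at h
    exact ⟨_, (r.inj h).symm⟩
  · rintro ⟨a, rfl⟩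
    obtain ⟨k, rfl⟩ := ZMod.intCast_surjective a
    exact ⟨Multiplicative.ofAdd k, rotHom_apply _ _⟩

theorem sr_notMem_rotSubgroup {c : ℕ} {j : ZMod 0} : sr j ∉ rotSubgroup c := by
  rintro ⟨k, h⟩
  rw [rotHom_apply] at h
  cases h

/-- Computes an index from an explicit complete invariant of left cosets. -/
theorem index_eq_card_of_surjective {Γ Y : Type*} [Group Γ] (B : Subgroup Γ) (f : Γ → Y)
    (hf : Function.Surjective f) (h : ∀ a b, f a = f b ↔ a⁻¹ * b ∈ B) : B.index = Nat.card Y := by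
  refine Nat.card_congr (Equiv.ofBijective
    (Quotient.lift f fun a b hab => (h a b).2 (QuotientGroup.leftRel_apply.1 hab)) ⟨?_, ?_⟩)
  · rintro ⟨a⟩ ⟨b⟩ hab
    exact QuotientGroup.eq.2 ((h a b).1 hab)
  · intro y
    obtain ⟨a, rfl⟩ := hf y
    exact ⟨(a : Γ ⧸ B), rfl⟩

/-- Reduction modulo `m`. -/
def red (m : ℕ) : ZMod 0 →+* ZMod m := ZMod.castHom (dvd_zero m) (ZMod m)

theorem red_surjective (m : ℕ) : Function.Surjective (red m) :=
  ZMod.ringHom_surjective _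

theorem red_eq_red_iff {m : ℕ} {a b : ZMod 0} : red m a = red m b ↔ (m : ZMod 0) ∣ b - a := by
  obtain ⟨a, rfl⟩ := ZMod.intCast_surjective a
  obtain ⟨b, rfl⟩ := ZMod.intCast_surjective b
  rw [map_intCast, map_intCast, ZMod.intCast_eq_intCast_iff_dvd_sub, ← Int.cast_sub]
  exact Iff.rfl

theorem index_range_scaleHom (m : ℕ) (i : ZMod 0) : (scaleHom m i).range.index = m := by
  rw [index_eq_card_of_surjective (Y := ZMod m) _ (fun
    | r j => red m j
    -- As `sr i` lies in the subgroup, `sr j` has the same left coset as `sr j * sr i = r (i - j)`.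
    | sr j => red m (i - j)), Nat.card_zmod]
  · intro y
    obtain ⟨a, rfl⟩ := red_surjective m y
    exact ⟨r a, rfl⟩
  · rintro (a | a) (b | b)
    · rw [red_eq_red_iff, inv_r, r_mul_r, r_mem_range_scaleHom, neg_add_eq_sub]
    · rw [red_eq_red_iff, inv_r, r_mul_sr, sr_mem_range_scaleHom, ← dvd_neg]
      ring_nf
    · rw [red_eq_red_iff, inv_sr, sr_mul_r, sr_mem_range_scaleHom]
      ring_nf
    · rw [red_eq_red_iff, inv_sr, sr_mul_sr, r_mem_range_scaleHom, ← dvd_neg]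
      ring_nf

/-- A left coset is determined by its kind, rotation or reflection, and a residue modulo `c`. -/
theorem index_rotSubgroup (c : ℕ) : (rotSubgroup c).index = 2 * c := by
  rw [index_eq_card_of_surjective (Y := Bool × ZMod c) _ (fun
    | r j => (false, red c j)
    | sr j => (true, red c (-j))), Nat.card_prod, Nat.card_zmod, Nat.card_eq_fintype_card,
      Fintype.card_bool]
  · rintro ⟨_ | _, y⟩
    · obtain ⟨a, rfl⟩ := red_surjective c y
      exact ⟨r a, rfl⟩
    · obtain ⟨a, rfl⟩ := red_surjective c y
      exact ⟨sr (-a), by simp⟩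
  · rintro (a | a) (b | b)
    · simp [red_eq_red_iff, r_mem_rotSubgroup, neg_add_eq_sub]
    · simp [sr_notMem_rotSubgroup]
    · simp [sr_notMem_rotSubgroup]
    · simp only [Prod.mk.injEq, true_and, red_eq_red_iff, inv_sr, sr_mul_sr, r_mem_rotSubgroup]
      rw [← dvd_neg]
      ring_nf

theorem natCast_zmod_zero_dvd {m n : ℕ} : (m : ZMod 0) ∣ n ↔ m ∣ n :=
  Int.natCast_dvd_natCast

theorem natCast_eq_of_dvd_iff {m n : ℕ} (h : ∀ j : ZMod 0, (m : ZMod 0) ∣ j ↔ (n : ZMod 0) ∣ j) :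
    m = n :=
  Nat.dvd_antisymm (natCast_zmod_zero_dvd.1 ((h n).2 dvd_rfl))
    (natCast_zmod_zero_dvd.1 ((h m).1 dvd_rfl))

/-- The rotations in `Q` form a subgroup of `ℤ`, hence a cyclic one; `c = 0` is the case without
nontrivial rotations. -/
theorem exists_r_mem_iff (Q : Subgroup (DihedralGroup 0)) :
    ∃ c : ℕ, ∀ j : ZMod 0, r j ∈ Q ↔ (c : ZMod 0) ∣ j := by
  let A : AddSubgroup ℤ :=
    { carrier := {j | r (Int.cast j : ZMod 0) ∈ Q}
      zero_mem' := by
        change r (Int.cast (0 : ℤ) : ZMod 0) ∈ Q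
        rw [Int.cast_zero, r_zero]
        exact Q.one_mem
      add_mem' := fun {a b} ha hb => by
        change r (Int.cast (a + b : ℤ) : ZMod 0) ∈ Q
        rw [Int.cast_add, ← r_mul_r]
        exact Q.mul_mem ha hb
      neg_mem' := fun {a} ha => by
        change r (Int.cast (-a : ℤ) : ZMod 0) ∈ Q
        rw [Int.cast_neg, ← inv_r]
        exact Q.inv_mem ha }
  obtain ⟨a, ha⟩ := Int.subgroup_cyclic A
  refine ⟨a.natAbs, fun j => ?_⟩
  obtain ⟨j, rfl⟩ := ZMod.intCast_surjective j
  change j ∈ A ↔ _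
  rw [ha, AddSubgroup.mem_closure_singleton]
  have : (∃ n : ℤ, n • a = j) ↔ a ∣ j :=
    ⟨fun ⟨n, h⟩ => ⟨n, by rw [← h, smul_eq_mul, mul_comm]⟩,
      fun ⟨n, h⟩ => ⟨n, by rw [h, smul_eq_mul, mul_comm]⟩⟩
  rw [this, ← Int.natAbs_dvd]
  exact Iff.rfl

theorem subgroup_dihedral_ext {Q Q' : Subgroup (DihedralGroup 0)}
    (hr : ∀ j, r j ∈ Q ↔ r j ∈ Q') (hsr : ∀ j, sr j ∈ Q ↔ sr j ∈ Q') : Q = Q' := by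
  ext (j | j)
  exacts [hr j, hsr j]

/-- A representative of a residue class. -/
noncomputable def lift (m : ℕ) (x : ZMod m) : ZMod 0 := Function.surjInv (red_surjective m) x

theorem red_lift {m : ℕ} (x : ZMod m) : red m (lift m x) = x :=
  Function.surjInv_eq (red_surjective m) x

theorem range_scaleHom_ne_rotSubgroup (m c : ℕ) (i : ZMod 0) :
    (scaleHom m i).range ≠ rotSubgroup c := fun h =>
  sr_notMem_rotSubgroup (h ▸ sr_mem_range_scaleHom.2 (by rw [sub_self]; exact dvd_zero _) :
    sr i ∈ rotSubgroup c)

/-- The subgroups of `D_∞`. -/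
noncomputable def dihedralSubgroupEquiv :
    (Σ m : ℕ, ZMod m) ⊕ ℕ ≃ Subgroup (DihedralGroup 0) :=
  Equiv.ofBijective (Sum.elim
      (fun t => (scaleHom t.1 (lift t.1 t.2)).range) rotSubgroup) (by
    constructor
    · rintro (⟨m, x⟩ | c) (⟨n, y⟩ | d) h
      · simp only [Sum.elim_inl] at h
        obtain rfl : m = n := natCast_eq_of_dvd_iff fun j => by
          rw [← r_mem_range_scaleHom, h, r_mem_range_scaleHom]
        have h1 : sr (lift m x) ∈ (scaleHom m (lift m y)).range := by
          rw [← h, sr_mem_range_scaleHom, sub_self]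
          exact dvd_zero _
        rw [sr_mem_range_scaleHom, ← red_eq_red_iff, red_lift, red_lift] at h1
        rw [h1]
      · exact absurd h (range_scaleHom_ne_rotSubgroup _ _ _)
      · exact absurd h.symm (range_scaleHom_ne_rotSubgroup _ _ _)
      · simp only [Sum.elim_inr] at h
        obtain rfl : c = d := natCast_eq_of_dvd_iff fun j => by
          rw [← r_mem_rotSubgroup, h, r_mem_rotSubgroup]
        rfl
    · intro Q
      obtain ⟨c, hc⟩ := exists_r_mem_iff Q
      by_cases hQ : ∃ i, sr i ∈ Q
      · obtain ⟨i, hi⟩ := hQ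
        -- Since `sr i * sr j = r (j - i)`, one reflection in `Q` and the rotations of `Q` determine
        -- all its reflections.
        refine ⟨.inl ⟨c, red c i⟩, subgroup_dihedral_ext (fun j => ?_) fun j => ?_⟩
        · rw [Sum.elim_inl, r_mem_range_scaleHom, hc]
        · rw [Sum.elim_inl, sr_mem_range_scaleHom, ← red_eq_red_iff, red_lift,
            red_eq_red_iff, ← hc, ← sr_mul_sr, Q.mul_mem_cancel_left hi]
      · refine ⟨.inr c, subgroup_dihedral_ext (fun j => ?_) fun j => ?_⟩
        · rw [Sum.elim_inr, r_mem_rotSubgroup, hc]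
        · exact iff_of_false sr_notMem_rotSubgroup fun h => hQ ⟨j, h⟩)

theorem index_dihedralSubgroupEquiv_inl (t : Σ m : ℕ, ZMod m) :
    (dihedralSubgroupEquiv (.inl t)).index = t.1 :=
  index_range_scaleHom _ _

theorem index_dihedralSubgroupEquiv_inr (c : ℕ) :
    (dihedralSubgroupEquiv (.inr c)).index = 2 * c :=
  index_rotSubgroup c

/-- Homomorphisms from `D_∞` to a group of exponent two. -/
def dihedralHomEquiv {K : Type*} [Group K] (hK : ∀ x : K, x * x = 1) :
    (DihedralGroup 0 →* K) ≃ K × K where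
  toFun f := (f (sr 0), f (sr 1))
  invFun p := dihedralLift p.1 p.2 (hK _) (hK _)
  left_inv _ := dihedral_hom_ext (dihedralLift_sr_zero _ _ _ _) (dihedralLift_sr_one _ _ _ _)
  right_inv _ := Prod.ext (dihedralLift_sr_zero _ _ _ _) (dihedralLift_sr_one _ _ _ _)

/-- Homomorphisms from the subgroups of `D_∞` that contain reflections. -/
noncomputable def dihedralSubgroupHomEquivInl {K : Type*} [Group K] (hK : ∀ x : K, x * x = 1)
    (t : Σ m : ℕ, ZMod m) (ht : t.1 ≠ 0) : (dihedralSubgroupEquiv (.inl t) →* K) ≃ K × K :=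
  (MonoidHom.ofInjective (scaleHom_injective ht _)).monoidHomCongrLeftEquiv.symm.trans
    (dihedralHomEquiv hK)

/-- Homomorphisms from the subgroups of `D_∞` that consist of rotations. -/
noncomputable def dihedralSubgroupHomEquivInr {K : Type*} [Group K]
    (c : ℕ) (hc : c ≠ 0) : (dihedralSubgroupEquiv (.inr c) →* K) ≃ K :=
  (MonoidHom.ofInjective (rotHom_injective hc)).monoidHomCongrLeftEquiv.symm.trans
    (zpowersHom K).symm

end Dihedral
-- Counting subgroups of `G × D_∞` by index.
/-- The number of subgroups `B` of index `k` of `G × D_∞`, with `G` elementary abelian, such that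
`B ∩ G` is a given subgroup of index `d` of `G`. -/
def fiberCount (d k : ℕ) : ℕ :=
  -- With `m = k / d`: `m` infinite dihedral subgroups of index `m`, each with `d²` homomorphisms to
  -- a quotient of order `d`, and for even `m` one rotation subgroup with `d` homomorphisms.
  if d ∣ k then k / d * d ^ 2 + if 2 ∣ k / d then d else 0 else 0

section Fiber
variable {K : Type} [Group K] {d k : ℕ}

/-- The subgroups of index `k / d` of `D_∞`. -/
noncomputable def indexDivEquiv (d k : ℕ) :
    ({t : Σ m : ℕ, ZMod m // d * t.1 = k} ⊕ {c : ℕ // d * (2 * c) = k}) ≃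
      {Q : Subgroup (DihedralGroup 0) // d * Q.index = k} :=
  ((Equiv.sumCongr
      (Equiv.subtypeEquivRight fun t => by rw [index_dihedralSubgroupEquiv_inl])
      (Equiv.subtypeEquivRight fun c => by rw [index_dihedralSubgroupEquiv_inr])).trans
    (Equiv.subtypeSum (p := fun x => d * (dihedralSubgroupEquiv x).index = k)).symm).trans
      (dihedralSubgroupEquiv.subtypeEquiv fun _ => Iff.rfl)

theorem indexDivEquiv_inl (t : {t : Σ m : ℕ, ZMod m // d * t.1 = k}) :
    (indexDivEquiv d k (.inl t)).1 = dihedralSubgroupEquiv (.inl t.1) := rfl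

theorem indexDivEquiv_inr (c : {c : ℕ // d * (2 * c) = k}) :
    (indexDivEquiv d k (.inr c)).1 = dihedralSubgroupEquiv (.inr c.1) := rfl

/-- Homomorphisms to `K` from the subgroups of index `k / d` that contain reflections. -/
noncomputable def indexDivHomEquivInl (hK : ∀ x : K, x * x = 1) (hk : k ≠ 0)
    (t : {t : Σ m : ℕ, ZMod m // d * t.1 = k}) :
    ((indexDivEquiv d k (.inl t)).1 →* K) ≃ K × K :=
  (MulEquiv.subgroupCongr (indexDivEquiv_inl t)).monoidHomCongrLeftEquiv.trans
    (dihedralSubgroupHomEquivInl hK t.1 fun h => hk (by rw [← t.2, h, mul_zero]))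

/-- Homomorphisms to `K` from the subgroups of index `k / d` that consist of rotations. -/
noncomputable def indexDivHomEquivInr (hk : k ≠ 0) (c : {c : ℕ // d * (2 * c) = k}) :
    ((indexDivEquiv d k (.inr c)).1 →* K) ≃ K :=
  (MulEquiv.subgroupCongr (indexDivEquiv_inr c)).monoidHomCongrLeftEquiv.trans
    (dihedralSubgroupHomEquivInr c.1 fun h => hk (by rw [← c.2, h, mul_zero, mul_zero]))

/-- Homomorphisms to `K` from the subgroups of index `k / d` of `D_∞`. -/
noncomputable def fiberEquiv (hK : ∀ x : K, x * x = 1) (hk : k ≠ 0) :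
    (Σ Q : {Q : Subgroup (DihedralGroup 0) // d * Q.index = k}, Q.1 →* K) ≃
      {t : Σ m : ℕ, ZMod m // d * t.1 = k} × (K × K) ⊕ {c : ℕ // d * (2 * c) = k} × K :=
  ((Equiv.sigmaCongrLeft (β := fun Q : {Q : Subgroup (DihedralGroup 0) // d * Q.index = k} =>
      Q.1 →* K) (indexDivEquiv d k)).symm.trans (Equiv.sumSigmaDistrib _)).trans
    (Equiv.sumCongr
      ((Equiv.sigmaCongrRight fun t => indexDivHomEquivInl hK hk t).trans
        (Equiv.sigmaEquivProd _ _))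
      ((Equiv.sigmaCongrRight fun c => indexDivHomEquivInr hk c).trans
        (Equiv.sigmaEquivProd _ _)))

/-- The residues modulo `k / d`. -/
def residueEquiv (hd : d ≠ 0) (h : d ∣ k) :
    {t : Σ m : ℕ, ZMod m // d * t.1 = k} ≃ ZMod (k / d) :=
  (Equiv.subtypeEquivRight fun t => by
    rw [eq_comm (a := t.1), Nat.div_eq_iff_eq_mul_right (Nat.pos_of_ne_zero hd) h, eq_comm]).trans
      (Equiv.sigmaSubtype (k / d))

theorem finite_residue (hd : d ≠ 0) (hk : k ≠ 0) :
    Finite {t : Σ m : ℕ, ZMod m // d * t.1 = k} := by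
  by_cases h : d ∣ k
  · have : NeZero (k / d) := ⟨(Nat.div_pos (Nat.le_of_dvd (Nat.pos_of_ne_zero hk) h)
      (Nat.pos_of_ne_zero hd)).ne'⟩
    exact Finite.of_equiv _ (residueEquiv hd h).symm
  · have : IsEmpty {t : Σ m : ℕ, ZMod m // d * t.1 = k} := ⟨fun t => h ⟨_, t.2.symm⟩⟩
    infer_instance

theorem card_residue (hd : d ≠ 0) :
    Nat.card {t : Σ m : ℕ, ZMod m // d * t.1 = k} = if d ∣ k then k / d else 0 := by
  split_ifs with h
  · rw [Nat.card_congr (residueEquiv hd h), Nat.card_zmod]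
  · have : IsEmpty {t : Σ m : ℕ, ZMod m // d * t.1 = k} := ⟨fun t => h ⟨_, t.2.symm⟩⟩
    exact Nat.card_of_isEmpty

theorem subsingleton_half (hd : d ≠ 0) : Subsingleton {c : ℕ // d * (2 * c) = k} := by
  refine ⟨fun a b => Subtype.ext ?_⟩
  have h := a.2.trans b.2.symm
  have := Nat.eq_of_mul_eq_mul_left (Nat.pos_of_ne_zero hd) h
  omega

theorem card_half (hd : d ≠ 0) : Nat.card {c : ℕ // d * (2 * c) = k} =
    if d ∣ k then (if 2 ∣ k / d then 1 else 0) else 0 := by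
  have := subsingleton_half (k := k) hd
  rw [← ite_and]
  split_ifs with h
  · obtain ⟨⟨m, rfl⟩, h2⟩ := h
    rw [Nat.mul_div_cancel_left _ (Nat.pos_of_ne_zero hd)] at h2
    obtain ⟨c, rfl⟩ := h2
    have : Nonempty {c' : ℕ // d * (2 * c') = d * (2 * c)} := ⟨⟨c, rfl⟩⟩
    exact Nat.card_unique
  · have : IsEmpty {c : ℕ // d * (2 * c) = k} := ⟨fun c => h (by
      obtain ⟨c, rfl⟩ := c
      rw [Nat.mul_div_cancel_left _ (Nat.pos_of_ne_zero hd)]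
      exact ⟨dvd_mul_right _ _, dvd_mul_right _ _⟩)⟩
    exact Nat.card_of_isEmpty

theorem finite_fiber [Finite K] (hK : ∀ x : K, x * x = 1) (hd : d ≠ 0) (hk : k ≠ 0) :
    Finite (Σ Q : {Q : Subgroup (DihedralGroup 0) // d * Q.index = k}, Q.1 →* K) := by
  have := finite_residue hd hk
  have := subsingleton_half (k := k) hd
  exact Finite.of_equiv _ (fiberEquiv hK hk).symm

theorem card_fiber [Finite K] (hK : ∀ x : K, x * x = 1) (hd : d ≠ 0) (hk : k ≠ 0)
    (hdK : Nat.card K = d) :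
    Nat.card (Σ Q : {Q : Subgroup (DihedralGroup 0) // d * Q.index = k}, Q.1 →* K) =
      fiberCount d k := by
  have := finite_residue hd hk
  have := subsingleton_half (k := k) hd
  rw [Nat.card_congr (fiberEquiv hK hk), Nat.card_sum, Nat.card_prod, Nat.card_prod, Nat.card_prod,
    card_residue hd, card_half hd, hdK, fiberCount]
  split_ifs <;> simp [pow_two]

end Fiber

section Count
variable {G Γ : Type} [CommGroup G] [Group Γ]

/-- Subgroups of index `k` of `G × Γ` in terms of Goursat data. -/
noncomputable def goursatIndexEquiv (G Γ : Type) [CommGroup G] [Group Γ] (k : ℕ) :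
    {B : Subgroup (G × Γ) // B.index = k} ≃
      Σ (H : Subgroup G) (Q : {Q : Subgroup Γ // H.index * Q.index = k}), Q.1 →* G ⧸ H :=
  ((goursatEquiv G Γ).subtypeEquiv (p := fun t => t.1.index * t.2.1.index = k) fun t => by
    rw [← index_goursatSubgroup t.1 t.2.1 t.2.2]; rfl).symm.trans
  { toFun := fun t => ⟨t.1.1, ⟨t.1.2.1, t.2⟩, t.1.2.2⟩
    invFun := fun t => ⟨⟨t.1, t.2.1.1, t.2.2⟩, t.2.1.2⟩
    left_inv := fun _ => rfl
    right_inv := fun _ => rfl }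

theorem quotient_mul_self (hG : ∀ x : G, x * x = 1) (H : Subgroup G) (x : G ⧸ H) : x * x = 1 := by
  obtain ⟨g, rfl⟩ := QuotientGroup.mk_surjective x
  rw [← QuotientGroup.mk_mul, hG, QuotientGroup.mk_one]

theorem finite_index_eq [Finite G] (hG : ∀ x : G, x * x = 1) {k : ℕ} (hk : k ≠ 0) :
    Finite {B : Subgroup (G × DihedralGroup 0) // B.index = k} := by
  have := fun H : Subgroup G => finite_fiber (d := H.index) (quotient_mul_self hG H)
    H.index_ne_zero_of_finite hk
  exact Finite.of_equiv _ (goursatIndexEquiv G (DihedralGroup 0) k).symm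

/-- Goursat data sorted by `H`. The quotient `G ⧸ H` has exponent dividing two and order `H.index`,
so `card_fiber` applies to each `H`. -/
theorem subgroupCount_prod_dihedral [Finite G] [Fintype (Subgroup G)] (hG : ∀ x : G, x * x = 1)
    {k : ℕ} (hk : k ≠ 0) :
    subgroupCount (G × DihedralGroup 0) k = ∑ H : Subgroup G, fiberCount H.index k := by
  have := fun H : Subgroup G => finite_fiber (d := H.index) (quotient_mul_self hG H)
    H.index_ne_zero_of_finite hk
  rw [subgroupCount, Nat.card_congr (goursatIndexEquiv G (DihedralGroup 0) k), Nat.card_sigma]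
  exact Finset.sum_congr rfl fun H _ => card_fiber (quotient_mul_self hG H)
    H.index_ne_zero_of_finite hk rfl

end Count

/-! ### The numbers `s_{2^j}` and the recursion for `h_{n,r} / n!`. -/

/-- `(ℤ/2ℤ)^r` in its two guises. -/
def elemTwoEquiv (r : ℕ) : Multiplicative (Fin r → ZMod 2) ≃* ElemTwo r where
  toFun x i := Multiplicative.ofAdd (x.toAdd i)
  invFun x := Multiplicative.ofAdd fun i => (x i).toAdd
  left_inv _ := rfl
  right_inv _ := rfl
  map_mul' _ _ := rfl

theorem s_eq_card (r d : ℕ) : s r d = Nat.card {H : Subgroup (ElemTwo r) // H.index = d} :=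
  Nat.card_congr ((AddSubgroup.toSubgroup.toEquiv.trans
    (elemTwoEquiv r).mapSubgroup.toEquiv).subtypeEquiv fun H => by
      change H.index = d ↔ (Subgroup.map (elemTwoEquiv r : _ →* ElemTwo r)
        (AddSubgroup.toSubgroup H)).index = d
      rw [Subgroup.index_map_equiv, AddSubgroup.index_toSubgroup])

theorem exists_index_eq_two_pow {r : ℕ} (H : Subgroup (ElemTwo r)) :
    ∃ j : Fin (r + 1), 2 ^ (j : ℕ) = H.index := by
  have h : H.index ∣ 2 ^ r := by
    have := H.index_dvd_card
    rwa [Nat.card_pi, Finset.prod_const, Finset.card_univ, Fintype.card_fin,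
      show Nat.card (Multiplicative (ZMod 2)) = 2 from Nat.card_zmod 2] at this
  obtain ⟨j, hj, h⟩ := (Nat.dvd_prime_pow Nat.prime_two).1 h
  exact ⟨⟨j, Nat.lt_succ_of_le hj⟩, h.symm⟩

/-- The contribution of `H` depends only on its index, a power of two, so equal indices are
collected. -/
theorem subgroupCount_elemTwo_prod_dihedral (r : ℕ) {k : ℕ} (hk : k ≠ 0) :
    subgroupCount (ElemTwo r × DihedralGroup 0) k =
      ∑ j : Fin (r + 1), s r (2 ^ (j : ℕ)) * fiberCount (2 ^ (j : ℕ)) k := by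
  classical
  have : Fintype (Subgroup (ElemTwo r)) := Fintype.ofFinite _
  rw [subgroupCount_prod_dihedral elemTwo_mul_self hk]
  choose e he using exists_index_eq_two_pow (r := r)
  rw [← Finset.sum_fiberwise (s := Finset.univ) (g := e)]
  refine Finset.sum_congr rfl fun j _ => ?_
  have hfilter : ∀ H : Subgroup (ElemTwo r), e H = j ↔ H.index = 2 ^ (j : ℕ) := fun H => by
    rw [← he, Nat.pow_right_inj one_lt_two, Fin.ext_iff]
  rw [Finset.sum_congr rfl fun H hH => by
    rw [(hfilter H).1 (Finset.mem_filter.1 hH).2], Finset.sum_const, smul_eq_mul, s_eq_card,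
    Nat.card_eq_fintype_card, Fintype.card_subtype, Finset.filter_congr fun H _ => hfilter H]

theorem finite_cox_hom (r n : ℕ) : Finite (Cox (graphA r) →* Equiv.Perm (Fin n)) :=
  Finite.of_injective (fun f v => f (PresentedGroup.of v)) fun _ _ h =>
    PresentedGroup.ext fun v => congrFun h v

/-- `h_{n,r} / n!`. -/
noncomputable def normCount (r n : ℕ) : ℚ := homCount (Cox (graphA r)) n / n.factorial

/-- Hall's recursion divided by `n!`: the falling factorial is `n! / (n - k)!`. -/
theorem normCount_mul (r n : ℕ) : normCount r n * n = ∑ k ∈ Finset.Icc 1 n,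
    (∑ j : Fin (r + 1), (s r (2 ^ (j : ℕ)) : ℚ) * fiberCount (2 ^ (j : ℕ)) k) *
      normCount r (n - k) := by
  have hfin : ∀ m, Finite (ElemTwo r × DihedralGroup 0 →* Equiv.Perm (Fin m)) := fun m =>
    have := finite_cox_hom r m
    Finite.of_equiv _ (coxEquivProd r).monoidHomCongrLeftEquiv
  have key := mul_homCount_eq_sum hfin
    (fun k hk => finite_index_eq (G := ElemTwo r) elemTwo_mul_self hk.ne') n
  have hfac : ∀ m : ℕ, (m.factorial : ℚ) ≠ 0 := fun m => by exact_mod_cast m.factorial_ne_zero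
  rw [normCount, div_mul_eq_mul_div, div_eq_iff (hfac n), homCount_congr (coxEquivProd r),
    ← Nat.cast_mul, key, Nat.cast_sum, Finset.sum_mul]
  refine Finset.sum_congr rfl fun k hk => ?_
  rw [Finset.mem_Icc] at hk
  rw [subgroupCount_elemTwo_prod_dihedral r (by omega), normCount,
    ← Nat.factorial_mul_descFactorial hk.2, homCount_congr (coxEquivProd r)]
  have := hfac (n - k)
  push_cast
  field_simp

/-! ### Generating series and the expansion of the denominators. -/

open PowerSeries

/-- The generating series of `fiberCount d`, without its constant term. -/
noncomputable def fiberSeries (d : ℕ) : ℚ⟦X⟧ :=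
  -- The formula gives `fiberCount d 0 = d`, which counts nothing relevant and must be suppressed.
  PowerSeries.mk fun k => if k = 0 then 0 else (fiberCount d k : ℚ)

/-- The series is `d² X / (1 - X)² + d X² / (1 - X²)`, put over the common denominator. -/
theorem fiberSeries_base (d : ℚ) :
    (PowerSeries.mk fun m : ℕ => if m = 0 then 0 else m * d ^ 2 + if 2 ∣ m then d else 0) *
      ((1 - X) ^ 2 * (1 + X)) =
      C (d ^ 2) * X + C (d + d ^ 2) * X ^ 2 - C d * X ^ 3 := by
  have h : ((1 - X) ^ 2 * (1 + X) : ℚ⟦X⟧) = 1 - X ^ 1 - X ^ 2 + X ^ 3 := by ring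
  rw [h, mul_add, mul_sub, mul_sub, mul_one]
  ext n
  have hr : coeff n (C (d ^ 2) * X + C (d + d ^ 2) * X ^ 2 - C d * X ^ 3) =
      d ^ 2 * (if n = 1 then 1 else 0) + (d + d ^ 2) * (if n = 2 then 1 else 0) -
        d * (if n = 3 then 1 else 0) := by
    rw [map_sub, map_add, coeff_C_mul, coeff_C_mul, coeff_C_mul, coeff_X, coeff_X_pow, coeff_X_pow]
  rw [hr]
  simp only [map_add, map_sub, coeff_mul_X_pow', coeff_mk]
  -- The numerator lives in degrees at most 3. From degree 4 on, the recursion only meets indices `≥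
  -- 1`, where the exceptional value at `0` plays no role.
  obtain _ | _ | _ | _ | n := n
  · simp
  · simp
  · simp; ring
  · simp [show ¬ (2 ∣ 3) by omega]; ring
  · have h1 : 2 ∣ n + 4 ↔ 2 ∣ n + 2 := by omega
    have h2 : 2 ∣ n + 3 ↔ 2 ∣ n + 1 := by omega
    simp [h1, h2]
    ring

/-- The denominator `(1 - X^d)^2 (1 + X^d)`. -/
noncomputable def denom (d : ℕ) : ℚ⟦X⟧ := (1 - X ^ d) ^ 2 * (1 + X ^ d)

/-- The substitution `X ↦ X^d` in `fiberSeries_base`, since `fiberCount d` is supported on multiples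
of `d`. -/
theorem fiberSeries_mul_denom {d : ℕ} (hd : d ≠ 0) :
    fiberSeries d * denom d =
      C ((d : ℚ) ^ 2) * X ^ d + C ((d : ℚ) + (d : ℚ) ^ 2) * X ^ (2 * d) -
        C (d : ℚ) * X ^ (3 * d) := by
  have h := congrArg (expand d hd) (fiberSeries_base d)
  have he : expand d hd (PowerSeries.mk fun m : ℕ =>
      if m = 0 then 0 else (m : ℚ) * (d : ℚ) ^ 2 + if 2 ∣ m then (d : ℚ) else 0) =
      fiberSeries d := by
    ext n
    rw [coeff_expand, coeff_mk, fiberSeries, coeff_mk, fiberCount]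
    by_cases hn : n = 0
    · simp [hn]
    · by_cases hdn : d ∣ n
      · have : n / d ≠ 0 := (Nat.div_pos (Nat.le_of_dvd (Nat.pos_of_ne_zero hn) hdn)
          (Nat.pos_of_ne_zero hd)).ne'
        simp only [hn, hdn, this, if_true, if_false]
        push_cast
        rfl
      · simp [hn, hdn]
  simp only [map_mul, map_add, map_sub, map_pow, map_one, he, expand_X, expand_C] at h
  simp only [map_add, map_pow] at h ⊢
  rw [denom, h, ← pow_mul, ← pow_mul, mul_comm d 2, mul_comm d 3]

/-- The monomial attached to a block `e = (ε_{j,1}, ε_{j,2}, ε_{j,3})`, at `y = X^(2^j)`. -/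
noncomputable def blockTerm (j : ℕ) (e : Fin 3 → Fin 2) : ℚ⟦X⟧ :=
  C ((-1 : ℚ) ^ ((e 0 : ℕ) + (e 1 : ℕ))) *
    X ^ (((e 0 : ℕ) + (e 1 : ℕ) + (e 2 : ℕ)) * 2 ^ j)

/-- Expansion of `(1 - y)(1 - y)(1 + y)` at `y = X^(2^j)`: each bit chooses `1` or the other term of
its factor, and only the first two carry a sign. -/
theorem sum_blockTerm (j : ℕ) : ∑ e, blockTerm j e = denom (2 ^ j) := by
  have h := Finset.prod_univ_sum (fun _ : Fin 3 => (Finset.univ : Finset (Fin 2)))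
    (fun i b => (if i = 2 then 1 else (-1 : ℚ⟦X⟧)) ^ (b : ℕ) * (X ^ 2 ^ j) ^ (b : ℕ))
  rw [Fintype.piFinset_univ] at h
  have h2 : ∀ e : Fin 3 → Fin 2, blockTerm j e =
      ∏ i, ((if i = 2 then 1 else (-1 : ℚ⟦X⟧)) ^ (e i : ℕ) * (X ^ 2 ^ j) ^ (e i : ℕ)) := by
    intro e
    simp only [Fin.prod_univ_three, blockTerm]
    simp
    ring
  rw [Finset.sum_congr rfl fun e _ => h2 e, ← h, Fin.prod_univ_three, denom]
  simp only [Fin.sum_univ_two, Fin.val_zero, Fin.val_one, pow_zero, pow_one, mul_one, if_true,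
    if_neg (show (0 : Fin 3) ≠ 2 by decide), if_neg (show (1 : Fin 3) ≠ 2 by decide)]
  ring

theorem prod_blockTerm {r : ℕ} (ε : I r) :
    ∏ j : Fin (r + 1), blockTerm j (ε j) = C (∏ j, sgn ε j) * X ^ wt ε := by
  rw [map_prod, wt, ← Finset.prod_pow_eq_pow_sum, ← Finset.prod_mul_distrib]
  rfl

theorem prod_denom (r : ℕ) :
    ∏ j : Fin (r + 1), denom (2 ^ (j : ℕ)) = ∑ ε : I r, C (∏ j, sgn ε j) * X ^ wt ε := by
  simp only [← sum_blockTerm, ← prod_blockTerm]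
  rw [Finset.prod_univ_sum, Fintype.piFinset_univ]

/-- Omitting the `j`-th denominator means keeping only its constant term `1`, that is, forcing the
`j`-th block of `ε` to vanish. -/
theorem prod_erase_denom (r : ℕ) (j : Fin (r + 1)) :
    ∏ k ∈ Finset.univ.erase j, denom (2 ^ (k : ℕ)) =
      ∑ ε ∈ vanishAt r j, C (∏ k ∈ Finset.univ.erase j, sgn ε k) * X ^ wt ε := by
  let t : Fin (r + 1) → Finset (Fin 3 → Fin 2) := fun k => if k = j then {0} else Finset.univ
  have ht : vanishAt r j = Fintype.piFinset t := by
    ext ε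
    simp only [vanishAt, Finset.mem_filter, Finset.mem_univ, true_and, Fintype.mem_piFinset, t]
    constructor
    · rintro ⟨h0, h1, h2⟩ k
      split_ifs with hk
      · subst hk
        rw [Finset.mem_singleton]
        ext i
        fin_cases i <;> simp [h0, h1, h2]
      · exact Finset.mem_univ _
    · intro h
      have := h j
      rw [if_pos rfl, Finset.mem_singleton] at this
      simp [this]
  have h1 : ∏ k : Fin (r + 1), ∑ e ∈ t k, blockTerm k e =
      ∏ k ∈ Finset.univ.erase j, denom (2 ^ (k : ℕ)) := by
    rw [← Finset.mul_prod_erase _ _ (Finset.mem_univ j)]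
    have : ∑ e ∈ t j, blockTerm j e = 1 := by simp [t, blockTerm]
    rw [this, one_mul]
    refine Finset.prod_congr rfl fun k hk => ?_
    simp only [t, if_neg (Finset.ne_of_mem_erase hk), sum_blockTerm]
  rw [← h1, Finset.prod_univ_sum, ht]
  refine Finset.sum_congr rfl fun ε hε => ?_
  rw [prod_blockTerm, ← Finset.mul_prod_erase _ _ (Finset.mem_univ j)]
  rw [← ht] at hε
  obtain ⟨h0, h1, -⟩ := (Finset.mem_filter.1 hε).2
  simp [sgn, h0, h1]

/-- The exponential generating series of `h_{n,r}`. -/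
noncomputable def homSeries (r : ℕ) : ℚ⟦X⟧ := PowerSeries.mk (normCount r)

/-- This is `X F' = F · ∑ t_k X^k`, the recursion `normCount_mul` read as a Cauchy product; its
extra term `k = 0` is zero. -/
theorem homSeries_log_deriv (r : ℕ) :
    (PowerSeries.mk fun n : ℕ => normCount r n * n) =
      homSeries r * ∑ j : Fin (r + 1), C (s r (2 ^ (j : ℕ)) : ℚ) * fiberSeries (2 ^ (j : ℕ)) := by
  ext n
  rw [coeff_mk, normCount_mul, mul_comm, coeff_mul,
    Finset.Nat.sum_antidiagonal_eq_sum_range_succ_mk]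
  have hsub : Finset.Icc 1 n ⊆ Finset.range n.succ := by
    intro k hk
    rw [Finset.mem_Icc] at hk
    rw [Finset.mem_range]
    omega
  rw [Finset.sum_subset_zero_on_sdiff hsub (g := fun k => coeff k (∑ j : Fin (r + 1),
    C (s r (2 ^ (j : ℕ)) : ℚ) * fiberSeries (2 ^ (j : ℕ))) * coeff (n - k) (homSeries r))]
  · intro k hk
    obtain rfl : k = 0 := by
      rw [Finset.mem_sdiff, Finset.mem_range, Finset.mem_Icc] at hk
      omega
    simp [fiberSeries]
  · intro k hk
    have hk0 : k ≠ 0 := by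
      rw [Finset.mem_Icc] at hk
      omega
    simp only [map_sum, coeff_C_mul, fiberSeries, homSeries, coeff_mk, if_neg hk0]

/-! ### Extraction of coefficients and the recursion. -/

theorem h_natCast (r n : ℕ) : h r n = homCount (Cox (graphA r)) n := by
  simp [h]

theorem h_of_neg (r : ℕ) {m : ℤ} (hm : m < 0) : h r m = 0 := if_neg (not_le.2 hm)

theorem h_zero (r : ℕ) : h r 0 = 1 := by
  rw [← Nat.cast_zero, h_natCast, homCount]
  have : Subsingleton (Cox (graphA r) →* Equiv.Perm (Fin 0)) :=
    ⟨fun f g => MonoidHom.ext fun _ => Subsingleton.elim _ _⟩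
  exact Nat.card_unique

theorem coeff_homSeries_mul (r n a : ℕ) :
    coeff n (homSeries r * X ^ a) = hDivFact r ((n : ℤ) - a) := by
  rw [coeff_mul_X_pow', homSeries, coeff_mk]
  split_ifs with ha
  · rw [← Nat.cast_sub ha, hDivFact, h_natCast, Int.toNat_natCast, normCount]
  · rw [hDivFact, h_of_neg r (by omega), Nat.cast_zero, zero_div]

theorem coeff_log_deriv_mul (r n a : ℕ) :
    coeff (n + 1) ((PowerSeries.mk fun n : ℕ => normCount r n * n) * X ^ a) =
      if a ≤ n then (h r ((n : ℤ) - a + 1) : ℚ) / (n - a).factorial else 0 := by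
  rw [coeff_mul_X_pow']
  split_ifs with h1 h2 h2
  · have e1 : n + 1 - a = n - a + 1 := by omega
    have e2 : (n : ℤ) - a + 1 = ((n - a + 1 : ℕ) : ℤ) := by omega
    rw [coeff_mk, e1, e2, h_natCast, normCount, Nat.factorial_succ]
    have : ((n - a).factorial : ℚ) ≠ 0 := by exact_mod_cast (n - a).factorial_ne_zero
    have : ((n - a : ℕ) : ℚ) + 1 ≠ 0 := by positivity
    push_cast
    field_simp
  -- The boundary case `a = n + 1`: the factor `n` of the logarithmic derivative kills the constant
  -- term, whence the condition `a ≤ n`.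
  · rw [coeff_mk, show n + 1 - a = 0 by omega, Nat.cast_zero, mul_zero]
  · omega
  · rfl

/-- In the `j`-th summand only the `j`-th denominator is consumed by its series; the other
denominators remain as a factor. -/
theorem log_deriv_mul_prod_denom (r : ℕ) :
    (PowerSeries.mk fun n : ℕ => normCount r n * n) * ∏ j : Fin (r + 1), denom (2 ^ (j : ℕ)) =
      ∑ j : Fin (r + 1), homSeries r * C (s r (2 ^ (j : ℕ)) : ℚ) *
        (C (((2 ^ (j : ℕ) : ℕ) : ℚ) ^ 2) * X ^ 2 ^ (j : ℕ) +
          C (((2 ^ (j : ℕ) : ℕ) : ℚ) + ((2 ^ (j : ℕ) : ℕ) : ℚ) ^ 2) * X ^ (2 * 2 ^ (j : ℕ)) -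
          C ((2 ^ (j : ℕ) : ℕ) : ℚ) * X ^ (3 * 2 ^ (j : ℕ))) *
        ∏ k ∈ Finset.univ.erase j, denom (2 ^ (k : ℕ)) := by
  rw [homSeries_log_deriv, Finset.mul_sum, Finset.sum_mul]
  refine Finset.sum_congr rfl fun j _ => ?_
  rw [← fiberSeries_mul_denom (pow_ne_zero _ two_ne_zero),
    ← Finset.mul_prod_erase _ _ (Finset.mem_univ j)]
  ring

theorem coeff_summand (r n : ℕ) (ε : I r) (σ u v w c : ℚ) (a b e : ℕ) :
    coeff n (homSeries r * C c * (C u * X ^ a + C v * X ^ b - C w * X ^ e) *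
      (C σ * X ^ wt ε)) =
      hDivFact r ((n : ℤ) - a - wt ε) * c * u * σ + hDivFact r ((n : ℤ) - b - wt ε) * c * v * σ -
        hDivFact r ((n : ℤ) - e - wt ε) * c * w * σ := by
  have : homSeries r * C c * (C u * X ^ a + C v * X ^ b - C w * X ^ e) * (C σ * X ^ wt ε) =
      C (c * u * σ) * (homSeries r * X ^ (a + wt ε)) +
      C (c * v * σ) * (homSeries r * X ^ (b + wt ε)) -
      C (c * w * σ) * (homSeries r * X ^ (e + wt ε)) := by
    simp only [map_mul, pow_add]
    ring
  rw [this]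
  simp only [map_add, map_sub, coeff_C_mul, coeff_homSeries_mul, Nat.cast_add, sub_sub]
  ring

end RACox

theorem corollary5p2 (r : ℕ) :
    RACox.h r 0 = 1 ∧
    (∀ m : ℤ, m < 0 → RACox.h r m = 0) ∧
    ∀ n : ℕ,
      (RACox.h r ((n : ℤ) + 1) : ℚ) / (n.factorial : ℚ) =
        - (∑ ε : RACox.I r with ε ≠ 0 ∧ RACox.wt ε ≤ n,
            (RACox.h r ((n : ℤ) - (RACox.wt ε : ℤ) + 1) : ℚ)
              / ((n - RACox.wt ε).factorial : ℚ) * ∏ j, RACox.sgn ε j)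
        + (∑ j : Fin (r + 1), ∑ ε ∈ RACox.vanishAt r j,
            RACox.hDivFact r ((n : ℤ) + 1 - 2 ^ (j : ℕ) - (RACox.wt ε : ℤ))
              * (RACox.s r (2 ^ (j : ℕ)) : ℚ) * 2 ^ (2 * (j : ℕ))
              * ∏ k ∈ Finset.univ.erase j, RACox.sgn ε k)
        + (∑ j : Fin (r + 1), ∑ ε ∈ RACox.vanishAt r j,
            RACox.hDivFact r ((n : ℤ) + 1 - 2 ^ ((j : ℕ) + 1) - (RACox.wt ε : ℤ))
              * (RACox.s r (2 ^ (j : ℕ)) : ℚ) * (2 ^ (j : ℕ) + 2 ^ (2 * (j : ℕ)))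
              * ∏ k ∈ Finset.univ.erase j, RACox.sgn ε k)
        - (∑ j : Fin (r + 1), ∑ ε ∈ RACox.vanishAt r j,
            RACox.hDivFact r ((n : ℤ) + 1 - 3 * 2 ^ (j : ℕ) - (RACox.wt ε : ℤ))
              * (RACox.s r (2 ^ (j : ℕ)) : ℚ) * 2 ^ (j : ℕ)
              * ∏ k ∈ Finset.univ.erase j, RACox.sgn ε k) := by
  refine ⟨RACox.h_zero r, fun m hm => RACox.h_of_neg r hm, fun n => ?_⟩
  have key := congrArg (PowerSeries.coeff (n + 1)) (RACox.log_deriv_mul_prod_denom r)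
  have hleft : PowerSeries.coeff (n + 1) ((PowerSeries.mk fun n : ℕ => RACox.normCount r n * n) *
      ∏ j : Fin (r + 1), RACox.denom (2 ^ (j : ℕ))) =
      (RACox.h r ((n : ℤ) + 1) : ℚ) / (n.factorial : ℚ) +
        ∑ ε : RACox.I r with ε ≠ 0 ∧ RACox.wt ε ≤ n,
          (RACox.h r ((n : ℤ) - (RACox.wt ε : ℤ) + 1) : ℚ)
            / ((n - RACox.wt ε).factorial : ℚ) * ∏ j, RACox.sgn ε j := by
    rw [RACox.prod_denom, Finset.mul_sum, map_sum,
      -- The term `ε = 0` has weight `0` and sign `1`: it is the left side of the recursion, and the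
      -- remaining terms change sides with a minus sign.
      ← Finset.add_sum_erase _ _ (Finset.mem_univ (0 : RACox.I r))]
    have hterm : ∀ ε : RACox.I r, PowerSeries.coeff (n + 1)
        ((PowerSeries.mk fun n : ℕ => RACox.normCount r n * n) *
          (PowerSeries.C (∏ j, RACox.sgn ε j) * PowerSeries.X ^ RACox.wt ε)) =
        if RACox.wt ε ≤ n then (RACox.h r ((n : ℤ) - (RACox.wt ε : ℤ) + 1) : ℚ)
            / ((n - RACox.wt ε).factorial : ℚ) * ∏ j, RACox.sgn ε j else 0 := by
      intro ε
      rw [mul_left_comm, PowerSeries.coeff_C_mul, RACox.coeff_log_deriv_mul, mul_comm, ite_mul,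
        zero_mul]
    simp only [hterm]
    congr 1
    · simp [RACox.wt, RACox.sgn]
    · rw [← Finset.sum_filter]
      refine Finset.sum_congr ?_ fun _ _ => rfl
      ext ε
      simp
  rw [hleft] at key
  rw [eq_sub_of_add_eq key, map_sum]
  simp only [RACox.prod_erase_denom, Finset.mul_sum, map_sum, RACox.coeff_summand]
  simp only [Finset.sum_sub_distrib, Finset.sum_add_distrib]
  push_cast
  have h1 : ∀ j : ℕ, (2 : ℚ) ^ (2 * j) = (2 ^ j) ^ 2 := fun j => by rw [mul_comm, pow_mul]
  have h2 : ∀ j : ℕ, (2 : ℤ) ^ (j + 1) = 2 * 2 ^ j := fun j => pow_succ' 2 j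
  simp only [h1, h2]
  ring
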